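/- Let $d\lambda(z)=\frac1\pi e^{-|z|^2}\,dA(z)$ be the Gaussian measure on $\mathbb C$ ($dA$ is area measure) and let $F^2=L^2(\mathbb C,d\lambda)\cap H(\mathbb C)$ be the Fock space, the Hilbert space of entire functions that are square integrable with respect to $d\lambda$, with the inner product inherited from $L^2(\mathbb C,d\lambda)$. For $(s,t)\in\mathbb C^2$ with $s\ne0$ put $$T^{(s,t)}f(z)=\int_{\mathbb C}K^{(s,t)}(z,w)f(w)\,d\lambda(w),\qquad K^{(s,t)}(z,w)=\frac1{\sqrt s}\exp\left[\frac{tz^2-\overline{tw^2}+2z\overline w}{2s}\right],$$ where $\sqrt{\phantom{s}}$ is the principal square root (argument in $(-\pi,\pi]$). Let $GL(\mathbb C\times\mathbb C)=\{(s,t)\in\mathbb C^2:|s|\ne|t|\}$ and $SL(\mathbb C\times\mathbb C)=\{(s,t)\in\mathbb C^2:|s|^2-|t|^2=1\}$. (i) $GL(\mathbb C\times\mathbb C)$ is a group under $$(s_1,t_1)\cdot(s_2,t_2)=(s_1s_2+\bar t_1t_2,\ t_1s_2+\bar s_1t_2),$$ and $SL(\mathbb C\times\mathbb C)$ is a subgroup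 of it. (ii) The map $$\varphi\begin{bmatrix}a&b\\c&d\end{bmatrix}=\left(\frac{a+ib+d-ic}2,\ \frac{a+ib-d+ic}2\right)$$ is a group isomorphism of $GL(2,\mathbb R)$ onto $GL(\mathbb C\times\mathbb C)$, and it maps $SL(2,\mathbb R)$ onto $SL(\mathbb C\times\mathbb C)$. (iii) For every $(s,t)\in SL(\mathbb C\times\mathbb C)$ and $f\in F^2$ the integral defining $T^{(s,t)}f(z)$ converges absolutely for all $z\in\mathbb C$ and defines an entire function in $F^2$, and $(s,t)\mapsto T^{(s,t)}$ is a unitary projective representation of $SL(\mathbb C\times\mathbb C)$ on $F^2$: each $T^{(s,t)}$ is a unitary operator on $F^2$, and for all $x,y\in SL(\mathbb C\times\mathbb C)$ there is a unimodular constant $\varepsilon$ with $T^{x\cdot y}=\varepsilon\,T^{x}T^{y}$. Moreover, $\varepsilon$ can be taken in $\{1,-1\}$. -/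

import Mathlib

open MeasureTheory Filter Topology
open scoped ENNReal

noncomputable section

/-- The Gaussian measure `dλ(z) = π⁻¹ exp(-|z|²) dA(z)` on the complex plane. -/
def gaussMeasure : Measure ℂ :=
  volume.withDensity fun z : ℂ => ENNReal.ofReal (1 / Real.pi * Real.exp (-‖z‖ ^ 2))

theorem enorm_le_lintegral_circle {h : ℂ → ℂ} (hh : Differentiable ℂ h) (z w : ℂ) :
    ENNReal.ofReal (2 * Real.pi) * ‖h z‖ₑ ≤
      ∫⁻ θ in Set.Ioc 0 (2 * Real.pi), ‖h (z + w * Complex.exp (θ * Complex.I))‖ₑ := by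
  have hp := Real.pi_pos
  have hg : Differentiable ℂ fun ζ : ℂ => h (z + w * ζ) := by fun_prop
  have h1 := DiffContOnCl.circleAverage (c := 0) (R := 1) hg.diffContOnCl
  rw [Real.circleAverage_def, intervalIntegral.integral_of_le (by positivity)] at h1
  simp only [mul_zero, add_zero, circleMap_zero, Complex.ofReal_one, one_mul] at h1
  have h2 : (2 * Real.pi) • h z =
      ∫ θ in Set.Ioc 0 (2 * Real.pi), h (z + w * Complex.exp (θ * Complex.I)) := by
    rw [← h1, smul_smul, mul_inv_cancel₀ (by positivity), one_smul]
  calc ENNReal.ofReal (2 * Real.pi) * ‖h z‖ₑ = ‖(2 * Real.pi) • h z‖ₑ := by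
        rw [enorm_smul, Real.enorm_of_nonneg (by positivity)]
    _ ≤ _ := by rw [h2]; exact enorm_integral_le_lintegral_enorm _

theorem volume_ball_mul_enorm_le {h : ℂ → ℂ} (hh : Differentiable ℂ h) (z : ℂ) :
    volume (Metric.ball (0 : ℂ) 1) * ‖h z‖ₑ ≤ ∫⁻ w in Metric.ball (0 : ℂ) 1, ‖h (z + w)‖ₑ := by
  have hp := Real.pi_pos
  have hc := hh.continuous
  have key : ENNReal.ofReal (2 * Real.pi) * (volume (Metric.ball (0 : ℂ) 1) * ‖h z‖ₑ) ≤
      ENNReal.ofReal (2 * Real.pi) * ∫⁻ w in Metric.ball (0 : ℂ) 1, ‖h (z + w)‖ₑ := by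
    calc _ = ∫⁻ w in Metric.ball (0 : ℂ) 1, ENNReal.ofReal (2 * Real.pi) * ‖h z‖ₑ := by
            rw [setLIntegral_const]; ring
      _ ≤ ∫⁻ w in Metric.ball (0 : ℂ) 1, ∫⁻ θ in Set.Ioc 0 (2 * Real.pi),
            ‖h (z + w * Complex.exp (θ * Complex.I))‖ₑ :=
          lintegral_mono fun w => enorm_le_lintegral_circle hh z w
      _ = ∫⁻ θ in Set.Ioc 0 (2 * Real.pi), ∫⁻ w in Metric.ball (0 : ℂ) 1,
            ‖h (z + w * Complex.exp ((θ : ℝ) * Complex.I))‖ₑ := by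
          rw [lintegral_lintegral_swap]
          exact Measurable.aemeasurable (by
            apply Continuous.measurable; unfold Function.uncurry; fun_prop)
      _ = ∫⁻ θ in Set.Ioc 0 (2 * Real.pi), ∫⁻ w in Metric.ball (0 : ℂ) 1, ‖h (z + w)‖ₑ := by
          refine lintegral_congr fun θ => ?_
          let e : ℂ ≃ₗᵢ[ℝ] ℂ := rotation (Circle.exp θ)
          have he : ∀ w, e w = w * Complex.exp ((θ : ℝ) * Complex.I) := fun w => by
            simp [e, rotation_apply, mul_comm]
          have hpre : e ⁻¹' Metric.ball (0 : ℂ) 1 = Metric.ball 0 1 := by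
            ext w; simp
          have := (e.measurePreserving).setLIntegral_comp_preimage
            (s := Metric.ball (0 : ℂ) 1) Metric.isOpen_ball.measurableSet
            (f := fun w => ‖h (z + w)‖ₑ) (by apply Continuous.measurable; fun_prop)
          rw [hpre] at this
          simpa only [he] using this
      _ = _ := by
          rw [setLIntegral_const, Real.volume_Ioc, sub_zero, mul_comm]
  exact (ENNReal.mul_le_mul_iff_right (by simpa using hp) ENNReal.ofReal_ne_top).1 key

theorem volume_restrict_ball_le (R : ℝ) :
    volume.restrict (Metric.ball (0 : ℂ) R) ≤
      ENNReal.ofReal (Real.pi * Real.exp (R ^ 2)) • gaussMeasure := by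
  refine Measure.le_iff.2 fun s hs => ?_
  have hp := Real.pi_pos
  rw [Measure.restrict_apply hs, Measure.smul_apply, smul_eq_mul, gaussMeasure,
    withDensity_apply _ hs, ← lintegral_const_mul' _ _ ENNReal.ofReal_ne_top]
  calc volume (s ∩ Metric.ball (0 : ℂ) R) = ∫⁻ _ in s ∩ Metric.ball (0 : ℂ) R, 1 := by simp
    _ ≤ ∫⁻ z in s ∩ Metric.ball (0 : ℂ) R, ENNReal.ofReal (Real.pi * Real.exp (R ^ 2)) *
          ENNReal.ofReal (1 / Real.pi * Real.exp (-‖z‖ ^ 2)) := by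
        refine setLIntegral_mono' (hs.inter Metric.isOpen_ball.measurableSet) fun z hz => ?_
        rw [← ENNReal.ofReal_mul (by positivity), ← ENNReal.ofReal_one]
        apply ENNReal.ofReal_le_ofReal
        have hz' : ‖z‖ < R := by simpa using hz.2
        have : Real.pi * Real.exp (R ^ 2) * (1 / Real.pi * Real.exp (-‖z‖ ^ 2)) =
            Real.exp (R ^ 2 + -‖z‖ ^ 2) := by rw [Real.exp_add]; field_simp
        rw [this, Real.one_le_exp_iff]
        nlinarith [norm_nonneg z]
    _ ≤ _ := lintegral_mono_set Set.inter_subset_left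

/-- Point evaluations of entire functions are bounded, locally uniformly, by the `L²` norm. -/
theorem exists_enorm_le_eLpNorm (R : ℝ) : ∃ C : ℝ≥0∞, C ≠ ⊤ ∧ ∀ h : ℂ → ℂ, Differentiable ℂ h →
    ∀ z ∈ Metric.ball (0 : ℂ) R, ‖h z‖ₑ ≤ C * eLpNorm h 2 gaussMeasure := by
  set V := volume (Metric.ball (0 : ℂ) 1) with hV
  have hV0 : V ≠ 0 := (Metric.measure_ball_pos volume (0 : ℂ) one_pos).ne'
  have hVt : V ≠ ⊤ := measure_ball_lt_top.ne
  set B := Metric.ball (0 : ℂ) (R + 1) with hB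
  have : IsFiniteMeasure (volume.restrict B) := ⟨by simpa using measure_ball_lt_top⟩
  set c := ENNReal.ofReal (Real.pi * Real.exp ((R + 1) ^ 2))
  refine ⟨V⁻¹ * (c ^ (2 : ℝ≥0∞).toReal⁻¹ *
    (volume.restrict B) Set.univ ^ (1 / (1 : ℝ≥0∞).toReal - 1 / (2 : ℝ≥0∞).toReal)), ?_, ?_⟩
  · refine ENNReal.mul_ne_top (ENNReal.inv_ne_top.2 hV0) (ENNReal.mul_ne_top ?_ ?_)
    · exact ENNReal.rpow_ne_top_of_nonneg (by positivity) ENNReal.ofReal_ne_top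
    · exact ENNReal.rpow_ne_top_of_nonneg (by norm_num) (measure_ne_top _ _)
  · intro h hh z hz
    have hc := hh.continuous
    have hz' : ‖z‖ < R := by simpa using hz
    have h1 : V * ‖h z‖ₑ ≤ eLpNorm h 1 (volume.restrict B) := by
      refine (volume_ball_mul_enorm_le hh z).trans ?_
      rw [eLpNorm_one_eq_lintegral_enorm]
      have hpre : (fun w => z + w) ⁻¹' Metric.ball z 1 = Metric.ball 0 1 := by
        ext w; simp
      have := (measurePreserving_add_left (volume : Measure ℂ) z).setLIntegral_comp_preimage
        (s := Metric.ball z 1) Metric.isOpen_ball.measurableSet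
        (f := fun w => ‖h w‖ₑ) (by apply Continuous.measurable; fun_prop)
      rw [hpre] at this
      rw [this]
      refine lintegral_mono_set fun w hw => ?_
      have hw' : ‖w - z‖ < 1 := by simpa [dist_eq_norm] using hw
      have := norm_add_le (w - z) z
      rw [sub_add_cancel] at this
      simp only [hB, Metric.mem_ball, dist_zero_right]
      linarith
    have h2 := eLpNorm_le_eLpNorm_mul_rpow_measure_univ (μ := volume.restrict B) (p := 1) (q := 2)
      (f := h) (by norm_num) hc.aestronglyMeasurable
    have h3 : eLpNorm h 2 (volume.restrict B) ≤
        c ^ (2 : ℝ≥0∞).toReal⁻¹ * eLpNorm h 2 gaussMeasure := by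
      refine (eLpNorm_mono_measure h (volume_restrict_ball_le (R + 1))).trans ?_
      rw [eLpNorm_smul_measure_of_ne_top (by norm_num), smul_eq_mul, one_div, ENNReal.toReal_inv]
    calc ‖h z‖ₑ = V⁻¹ * (V * ‖h z‖ₑ) := by
          rw [← mul_assoc, ENNReal.inv_mul_cancel hV0 hVt, one_mul]
      _ ≤ V⁻¹ * ((c ^ (2 : ℝ≥0∞).toReal⁻¹ * eLpNorm h 2 gaussMeasure) *
          (volume.restrict B) Set.univ ^
            (1 / (1 : ℝ≥0∞).toReal - 1 / (2 : ℝ≥0∞).toReal)) := by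
          refine mul_le_mul_right (h1.trans (h2.trans ?_)) _
          gcongr
      _ = _ := by ring

/-- The Fock space `F² = L²(ℂ, dλ) ∩ H(ℂ)`: the classes in `L²(ℂ, dλ)` that have an entire
representative, with the inner product inherited from `L²(ℂ, dλ)`. -/
def fockSpace : Submodule ℂ (Lp ℂ 2 gaussMeasure) where
  carrier := {f | ∃ g : ℂ → ℂ, Differentiable ℂ g ∧ f =ᵐ[gaussMeasure] g}
  zero_mem' := ⟨0, differentiable_const 0, Lp.coeFn_zero ℂ 2 gaussMeasure⟩
  add_mem' := by
    rintro f₁ f₂ ⟨g₁, h₁, e₁⟩ ⟨g₂, h₂, e₂⟩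
    exact ⟨g₁ + g₂, h₁.add h₂, (Lp.coeFn_add f₁ f₂).trans (e₁.add e₂)⟩
  smul_mem' := by
    rintro c f ⟨g, h, e⟩
    exact ⟨c • g, h.const_smul c, (Lp.coeFn_smul c f).trans (e.const_smul c)⟩

theorem isClosed_fockSpace : IsClosed (fockSpace : Set (Lp ℂ 2 gaussMeasure)) := by
  refine isClosed_of_closure_subset fun f hf => ?_
  obtain ⟨F, hF, hlim⟩ := mem_closure_iff_seq_limit.1 hf
  choose g hg hFg using hF
  have hdiff : ∀ m n, eLpNorm (g m - g n) 2 gaussMeasure = edist (F m) (F n) := fun m n => by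
    rw [Lp.edist_def]
    exact (eLpNorm_congr_ae ((hFg m).sub (hFg n))).symm
  have hcau : ∀ R, UniformCauchySeqOn g atTop (Metric.ball (0 : ℂ) R) := by
    intro R
    obtain ⟨C, hC, hb⟩ := exists_enorm_le_eLpNorm R
    intro u hu
    obtain ⟨ε, hε, hεu⟩ := mem_uniformity_edist.1 hu
    obtain ⟨δ, hδ, hδε⟩ : ∃ δ : ℝ≥0∞, 0 < δ ∧ C * δ < ε := by
      have : Tendsto (fun δ => C * δ) (𝓝[>] 0) (𝓝 (C * 0)) :=
        (ENNReal.Tendsto.const_mul tendsto_id (Or.inr hC)).mono_left nhdsWithin_le_nhds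
      rw [mul_zero] at this
      exact ((eventually_mem_nhdsWithin).and (this.eventually (gt_mem_nhds hε))).exists
    obtain ⟨N, hN⟩ := EMetric.cauchySeq_iff.1 hlim.cauchySeq δ hδ
    filter_upwards [(eventually_ge_atTop N).prod_mk (eventually_ge_atTop N)]
    rintro ⟨m, n⟩ ⟨hm, hn⟩ z hz
    have := hb (g m - g n) ((hg m).sub (hg n)) z hz
    rw [hdiff] at this
    apply hεu
    rw [edist_eq_enorm_sub]
    exact (this.trans (by gcongr; exact (hN m hm n hn).le)).trans_lt hδε
  have hpt : ∀ z, ∃ y, Tendsto (fun n => g n z) atTop (𝓝 y) := fun z =>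
    cauchySeq_tendsto_of_complete ((hcau (‖z‖ + 1)).cauchySeq (by simp))
  choose G hG using hpt
  have hGd : Differentiable ℂ G := by
    rw [← differentiableOn_univ]
    refine TendstoLocallyUniformlyOn.differentiableOn (F := g) (φ := atTop) ?_
      (Eventually.of_forall fun n => (hg n).differentiableOn) isOpen_univ
    intro u hu z _
    refine ⟨Metric.ball 0 (‖z‖ + 1),
      mem_nhdsWithin_of_mem_nhds (Metric.isOpen_ball.mem_nhds (by simp)), ?_⟩
    exact (hcau (‖z‖ + 1)).tendstoUniformlyOn_of_tendsto (fun z _ => hG z) u hu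
  obtain ⟨ns, hns, hae⟩ := (tendstoInMeasure_of_tendsto_Lp hlim).exists_seq_tendsto_ae
  refine ⟨G, hGd, ?_⟩
  filter_upwards [hae, ae_all_iff.2 hFg] with z hz hz'
  refine tendsto_nhds_unique hz ?_
  simp only [hz']
  exact (hG z).comp hns.tendsto_atTop

instance : CompleteSpace fockSpace := isClosed_fockSpace.completeSpace_coe

/-- The kernel `K^{(s,t)}(z,w) = s^{-1/2} exp[(t z² - conj(t w²) + 2 z conj(w)) / (2 s)]`, with the
principal square root (argument in `(-π, π]`). -/
def fockKernel (s t z w : ℂ) : ℂ :=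
  1 / Complex.sqrt s *
    Complex.exp ((t * z ^ 2 - starRingEnd ℂ (t * w ^ 2) + 2 * z * starRingEnd ℂ w) / (2 * s))

/-- The function `T^{(s,t)} f`, i.e. `z ↦ ∫ K^{(s,t)}(z,w) f(w) dλ(w)`. -/
def fockTransform (s t : ℂ) (f : ℂ → ℂ) (z : ℂ) : ℂ :=
  ∫ w, fockKernel s t z w * f w ∂gaussMeasure

/-- `GL(ℂ × ℂ)`, as a set of pairs. -/
def GLCC : Set (ℂ × ℂ) := {p | ‖p.1‖ ≠ ‖p.2‖}

/-- `SL(ℂ × ℂ)`, as a set of pairs. -/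
def SLCC : Set (ℂ × ℂ) := {p | ‖p.1‖ ^ 2 - ‖p.2‖ ^ 2 = 1}

/-- The product `(s₁, t₁) · (s₂, t₂) = (s₁ s₂ + conj(t₁) t₂, t₁ s₂ + conj(s₁) t₂)`. -/
def pairMul (p q : ℂ × ℂ) : ℂ × ℂ :=
  (p.1 * q.1 + starRingEnd ℂ p.2 * q.2, p.2 * q.1 + starRingEnd ℂ p.1 * q.2)

/-- The pair of complex numbers attached to a real matrix with rows `(a, b)` and `(c, d)`. -/
def matrixToPair (A : Matrix (Fin 2) (Fin 2) ℝ) : ℂ × ℂ :=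
  let a : ℂ := A 0 0
  let b : ℂ := A 0 1
  let c : ℂ := A 1 0
  let d : ℂ := A 1 1
  ((a + b * Complex.I + d - c * Complex.I) / 2, (a + b * Complex.I - d + c * Complex.I) / 2)

/-- A unitary projective (ray) representation of a group on a complex Hilbert space. -/
structure IsUnitaryProjectiveRep {G H : Type*} [Group G] [NormedAddCommGroup H]
    [InnerProductSpace ℂ H] [CompleteSpace H] (ρ : G → H →L[ℂ] H) : Prop where
  unitary_apply : ∀ x, ρ x ∈ unitary (H →L[ℂ] H)
  map_mul : ∀ x y, ∃ c : ℂ, ‖c‖ = 1 ∧ ρ (x * y) = c • (ρ x * ρ y)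

end

noncomputable section

/-! A pair `(s, t)` encodes the matrix with rows `(s, conj t)` and `(t, conj s)`: `pairMul` is the
first column of the matrix product and `|s|² - |t|²` is the determinant. This gives the algebraic
half.

For the analytic half, `F²` has reproducing vectors `fockExp a` with dense span, and `T` must send
`fockExp a` to `K(·, a)`. A Gaussian integral shows that these images have the same Gram matrix as
the `fockExp a` (`inner_fockKernelRight`), so the assignment extends to an isometry `fockOp`.
Pairing with `fockExp z` identifies `fockOp` with the integral operator (`inner_fockExp_fockOp`).

A second Gaussian integral composes two kernels (`exists_sign_fockKernel_pairMul`). Its prefactor is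
known only through its square, so the multiplier squares to 1. Composing with the operator of the
inverse then gives surjectivity, hence unitarity. -/

/-! ### The group of pairs and its determinant. -/

theorem normSq_pairMul (p q : ℂ × ℂ) :
    Complex.normSq (pairMul p q).1 - Complex.normSq (pairMul p q).2 =
      (Complex.normSq p.1 - Complex.normSq p.2) * (Complex.normSq q.1 - Complex.normSq q.2) := by
  simp only [pairMul, Complex.normSq_apply, Complex.add_re, Complex.add_im, Complex.mul_re,
    Complex.mul_im, Complex.conj_re, Complex.conj_im]
  ring

theorem pairMul_assoc (p q r : ℂ × ℂ) :
    pairMul (pairMul p q) r = pairMul p (pairMul q r) := by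
  simp only [pairMul, map_add, map_mul, Complex.conj_conj, Prod.mk.injEq]
  constructor <;> ring

/-- The determinant-like quantity `|s|² - |t|²`. -/
def pairDet (p : ℂ × ℂ) : ℝ := Complex.normSq p.1 - Complex.normSq p.2

theorem pairDet_mul (p q : ℂ × ℂ) : pairDet (pairMul p q) = pairDet p * pairDet q :=
  normSq_pairMul p q

theorem mem_GLCC_iff {p : ℂ × ℂ} : p ∈ GLCC ↔ pairDet p ≠ 0 := by
  rw [GLCC, Set.mem_ofPred_eq, pairDet, Complex.normSq_eq_norm_sq, Complex.normSq_eq_norm_sq, Ne,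
    Ne, sub_eq_zero, sq_eq_sq₀ (norm_nonneg _) (norm_nonneg _)]

theorem mem_SLCC_iff {p : ℂ × ℂ} : p ∈ SLCC ↔ pairDet p = 1 := by
  rw [SLCC, Set.mem_ofPred_eq, pairDet, Complex.normSq_eq_norm_sq, Complex.normSq_eq_norm_sq]

/-- The inverse of a pair for the product `pairMul`. -/
def pairInv (p : ℂ × ℂ) : ℂ × ℂ :=
  (starRingEnd ℂ p.1 / pairDet p, -p.2 / pairDet p)

theorem pairDet_one : pairDet (1, 0) = 1 := by simp [pairDet]

/-- `pairInv` is the first column of the adjugate matrix divided by the determinant. -/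
theorem pairMul_inv_left {p : ℂ × ℂ} (hp : pairDet p ≠ 0) :
    pairMul (pairInv p) p = (1, 0) := by
  have hp' : (pairDet p : ℂ) ≠ 0 := by exact_mod_cast hp
  have key : (pairDet p : ℂ) = starRingEnd ℂ p.1 * p.1 - starRingEnd ℂ p.2 * p.2 := by
    rw [pairDet, Complex.ofReal_sub, Complex.normSq_eq_conj_mul_self,
      Complex.normSq_eq_conj_mul_self]
  simp only [pairMul, pairInv, map_div₀, map_neg, Complex.conj_conj, Complex.conj_ofReal,
    Prod.mk.injEq]
  constructor
  · field_simp
    rw [key]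
    ring
  · field_simp
    ring

theorem pairDet_inv {p : ℂ × ℂ} (hp : pairDet p ≠ 0) : pairDet (pairInv p) ≠ 0 := fun h => by
  have := pairDet_mul (pairInv p) p
  rw [pairMul_inv_left hp, pairDet_one, h, zero_mul] at this
  exact one_ne_zero this

local instance : Mul GLCC :=
  ⟨fun x y => ⟨pairMul x y, mem_GLCC_iff.2 (by
    rw [pairDet_mul]; exact mul_ne_zero (mem_GLCC_iff.1 x.2) (mem_GLCC_iff.1 y.2))⟩⟩

local instance : One GLCC := ⟨⟨(1, 0), mem_GLCC_iff.2 (by rw [pairDet_one]; exact one_ne_zero)⟩⟩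

local instance : Inv GLCC :=
  ⟨fun x => ⟨pairInv x, mem_GLCC_iff.2 (pairDet_inv (mem_GLCC_iff.1 x.2))⟩⟩

local instance groupGLCC : Group GLCC :=
  Group.ofLeftAxioms (fun x y z => Subtype.ext (pairMul_assoc x y z))
    (fun x => Subtype.ext (by
      change pairMul (1, 0) x = x
      simp [pairMul]))
    (fun x => Subtype.ext (pairMul_inv_left (mem_GLCC_iff.1 x.2)))

theorem coe_mul_GLCC (x y : GLCC) : ((x * y : GLCC) : ℂ × ℂ) = pairMul x y := rfl

/-- `|s|² - |t|²` as a homomorphism to the nonzero reals. -/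
def pairDetHom : GLCC →* ℝ where
  toFun x := pairDet x
  map_one' := pairDet_one
  map_mul' x y := pairDet_mul x y

/-- `SL(ℂ × ℂ)` as a subgroup of `GL(ℂ × ℂ)`. -/
def SLCCSubgroup : Subgroup GLCC := pairDetHom.ker

theorem mem_SLCCSubgroup {x : GLCC} : x ∈ SLCCSubgroup ↔ pairDet x = 1 := Iff.rfl

theorem image_SLCCSubgroup :
    (Subtype.val '' (SLCCSubgroup : Set GLCC) : Set (ℂ × ℂ)) = SLCC := by
  ext p
  rw [mem_SLCC_iff]
  constructor
  · rintro ⟨x, hx, rfl⟩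
    exact hx
  · intro hp
    exact ⟨⟨p, mem_GLCC_iff.2 (by rw [hp]; exact one_ne_zero)⟩, hp, rfl⟩

/-! ### The isomorphism with real matrices. -/

theorem pairDet_matrixToPair (A : Matrix (Fin 2) (Fin 2) ℝ) :
    pairDet (matrixToPair A) = A.det := by
  simp [pairDet, matrixToPair, Matrix.det_fin_two, Complex.normSq_apply]
  ring

/-- A change of basis: for `z = x + iy`, a real matrix acting on columns `(x, y)` becomes, in the
coordinates `(conj z, z)`, the matrix with rows `(s, conj t)` and `(t, conj s)`. -/
theorem matrixToPair_mul (A B : Matrix (Fin 2) (Fin 2) ℝ) :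
    matrixToPair (A * B) = pairMul (matrixToPair A) (matrixToPair B) := by
  simp only [matrixToPair, pairMul, Matrix.mul_apply, Fin.sum_univ_two, map_div₀, map_add, map_sub,
    map_mul, Complex.conj_ofReal, Complex.conj_I, map_ofNat, Complex.ofReal_add, Complex.ofReal_mul]
  ext1 <;> apply Complex.ext <;> simp <;> ring

/-- The real matrix with a given pair. -/
def pairToMatrix (p : ℂ × ℂ) : Matrix (Fin 2) (Fin 2) ℝ :=
  !![p.1.re + p.2.re, p.1.im + p.2.im; p.2.im - p.1.im, p.1.re - p.2.re]

theorem matrixToPair_pairToMatrix (p : ℂ × ℂ) : matrixToPair (pairToMatrix p) = p := by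
  simp only [matrixToPair, pairToMatrix]
  ext1 <;> apply Complex.ext <;> simp <;> ring

theorem pairToMatrix_matrixToPair (A : Matrix (Fin 2) (Fin 2) ℝ) :
    pairToMatrix (matrixToPair A) = A := by
  simp only [matrixToPair, pairToMatrix]
  ext i j
  fin_cases i <;> fin_cases j <;> simp <;> ring

/-- The isomorphism of `GL(2, ℝ)` onto `GL(ℂ × ℂ)`. -/
def GLEquivGLCC : GL (Fin 2) ℝ ≃* GLCC where
  toFun A := ⟨matrixToPair A, mem_GLCC_iff.2 (by
    rw [pairDet_matrixToPair]; exact A.det.ne_zero)⟩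
  invFun x := Matrix.GeneralLinearGroup.mkOfDetNeZero (pairToMatrix x) (by
    rw [← pairDet_matrixToPair, matrixToPair_pairToMatrix]; exact mem_GLCC_iff.1 x.2)
  left_inv A := Units.ext (pairToMatrix_matrixToPair A)
  right_inv x := Subtype.ext (matrixToPair_pairToMatrix x)
  map_mul' A B := Subtype.ext (matrixToPair_mul A B)

theorem coe_GLEquivGLCC (A : GL (Fin 2) ℝ) :
    (GLEquivGLCC A : ℂ × ℂ) = matrixToPair (A : Matrix (Fin 2) (Fin 2) ℝ) := rfl

theorem image_GLEquivGLCC :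
    GLEquivGLCC '' {A : GL (Fin 2) ℝ | (A : Matrix (Fin 2) (Fin 2) ℝ).det = 1} =
      (SLCCSubgroup : Set GLCC) := by
  ext x
  obtain ⟨A, rfl⟩ := GLEquivGLCC.surjective x
  simp only [Set.mem_image, EmbeddingLike.apply_eq_iff_eq, exists_eq_right, SetLike.mem_coe,
    mem_SLCCSubgroup, coe_GLEquivGLCC, pairDet_matrixToPair, Set.mem_ofPred_eq]

/-! ### Gaussian integrals of exponentials of quadratics. -/

theorem gaussMeasure_eq_withDensity_nnreal : gaussMeasure = volume.withDensity fun z : ℂ =>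
    ((1 / Real.pi * Real.exp (-‖z‖ ^ 2)).toNNReal : ℝ≥0∞) := rfl

theorem integral_gaussMeasure (f : ℂ → ℂ) :
    ∫ z, f z ∂gaussMeasure =
      1 / Real.pi * ∫ z : ℂ, Complex.exp (-(‖z‖ : ℂ) ^ 2) * f z := by
  have hp := Real.pi_pos
  rw [gaussMeasure_eq_withDensity_nnreal, integral_withDensity_eq_integral_smul (by fun_prop),
    ← integral_const_mul]
  refine integral_congr_ae (Eventually.of_forall fun z => ?_)
  simp only [NNReal.smul_def, Complex.real_smul]
  rw [Real.coe_toNNReal _ (by positivity)]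
  push_cast
  ring

theorem integrable_gaussMeasure_iff {f : ℂ → ℂ} :
    Integrable f gaussMeasure ↔
      Integrable fun z : ℂ => Complex.exp (-(‖z‖ : ℂ) ^ 2) * f z := by
  have hp := Real.pi_pos
  rw [gaussMeasure_eq_withDensity_nnreal, integrable_withDensity_iff_integrable_smul (by fun_prop)]
  have : (fun z : ℂ => (1 / Real.pi * Real.exp (-‖z‖ ^ 2)).toNNReal • f z) =
      fun z => ((1 / Real.pi : ℝ) : ℂ) * (Complex.exp (-(‖z‖ : ℂ) ^ 2) * f z) := by
    funext z
    simp only [NNReal.smul_def, Complex.real_smul]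
    rw [Real.coe_toNNReal _ (by positivity)]
    push_cast
    ring
  rw [this, integrable_const_mul_iff]
  exact (Ne.isUnit (by simp))

/-- The exponential of the quadratic `a u² / 2 + b ū² / 2 + c u + d ū`. -/
def quadExp (a b c d u : ℂ) : ℂ :=
  Complex.exp (a * u ^ 2 / 2 + b * starRingEnd ℂ u ^ 2 / 2 + c * u + d * starRingEnd ℂ u)

/-- The quadratic part decays at least like `exp(-2δ|z|²)`. Half of this decay absorbs the linear
part through `M|z| ≤ M²/(4δ) + δ|z|²`; the other half is an integrable majorant. -/
theorem integrable_volume_quadExp {a b : ℂ} (ha : ‖a‖ < 1) (hb : ‖b‖ < 1) (c d : ℂ) :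
    Integrable fun z : ℂ => Complex.exp (-(‖z‖ : ℂ) ^ 2) * quadExp a b c d z := by
  set δ := (1 - (‖a‖ + ‖b‖) / 2) / 2 with hδ
  have hδ0 : 0 < δ := by rw [hδ]; linarith
  set M := ‖c‖ + ‖d‖ with hM
  have h1 := (GaussianFourier.integrable_cexp_neg_mul_sq_norm_add (V := ℂ) (b := δ)
    (by simpa using hδ0) 0 0).const_mul (Complex.exp (M ^ 2 / (4 * δ) : ℝ))
  refine h1.mono (Continuous.aestronglyMeasurable (by unfold quadExp; fun_prop))
    (Eventually.of_forall fun z => ?_)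
  rw [quadExp, ← Complex.exp_add, zero_mul, add_zero, ← Complex.exp_add, Complex.norm_exp,
    Complex.norm_exp, Real.exp_le_exp]
  have e1 : (a * z ^ 2 / 2).re ≤ ‖a‖ * ‖z‖ ^ 2 / 2 :=
    (Complex.re_le_norm _).trans (by simp)
  have e2 : (b * starRingEnd ℂ z ^ 2 / 2).re ≤ ‖b‖ * ‖z‖ ^ 2 / 2 :=
    (Complex.re_le_norm _).trans (by simp)
  have e3 : (c * z).re ≤ ‖c‖ * ‖z‖ := (Complex.re_le_norm _).trans (by simp)
  have e4 : (d * starRingEnd ℂ z).re ≤ ‖d‖ * ‖z‖ := (Complex.re_le_norm _).trans (by simp)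
  have e5 : (-(‖z‖ : ℂ) ^ 2).re = -‖z‖ ^ 2 := by
    rw [Complex.neg_re, ← Complex.ofReal_pow, Complex.ofReal_re]
  have e6 : (((M ^ 2 / (4 * δ) : ℝ) : ℂ) + -(δ : ℂ) * (‖z‖ : ℂ) ^ 2).re =
      M ^ 2 / (4 * δ) - δ * ‖z‖ ^ 2 := by
    rw [← Complex.ofReal_pow, ← Complex.ofReal_neg, ← Complex.ofReal_mul, ← Complex.ofReal_add,
      Complex.ofReal_re]
    ring
  rw [e6]
  simp only [Complex.add_re, e5]
  have e7 : M * ‖z‖ ≤ M ^ 2 / (4 * δ) + δ * ‖z‖ ^ 2 := by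
    have : M ^ 2 / (4 * δ) + δ * ‖z‖ ^ 2 - M * ‖z‖ = (M - 2 * δ * ‖z‖) ^ 2 / (4 * δ) := by
      field_simp
      ring
    have : 0 ≤ (M - 2 * δ * ‖z‖) ^ 2 / (4 * δ) := by positivity
    linarith
  have e8 : (‖a‖ + ‖b‖) / 2 = 1 - 2 * δ := by rw [hδ]; ring
  have e9 : ‖a‖ * ‖z‖ ^ 2 / 2 + ‖b‖ * ‖z‖ ^ 2 / 2 = (1 - 2 * δ) * ‖z‖ ^ 2 := by
    rw [← e8]; ring
  have e10 : ‖c‖ * ‖z‖ + ‖d‖ * ‖z‖ = M * ‖z‖ := by rw [hM]; ring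
  linarith

theorem integrable_quadExp {a b : ℂ} (ha : ‖a‖ < 1) (hb : ‖b‖ < 1) (c d : ℂ) :
    Integrable (quadExp a b c d) gaussMeasure :=
  integrable_gaussMeasure_iff.2 (integrable_volume_quadExp ha hb c d)

theorem one_sub_mul_ne_zero {a b : ℂ} (ha : ‖a‖ < 1) (hb : ‖b‖ < 1) : 1 - a * b ≠ 0 := by
  intro h
  have : ‖a * b‖ = 1 := by rw [← sub_eq_zero.1 h, norm_one]
  rw [norm_mul] at this
  nlinarith [norm_nonneg a, norm_nonneg b]

/-- This quotient is the coefficient of `-y²` left after integrating out `x` in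
`exists_integral_quadExp`; positivity of its real part makes the outer integral converge. The
identity `key` writes it as a sum of nonnegative terms, one of them positive. -/
theorem re_div_pos_of_norm_lt_one {a b : ℂ} (ha : ‖a‖ < 1) (hb : ‖b‖ < 1) :
    0 < ((1 - a * b) / (1 - (a + b) / 2)).re := by
  have h0 : 0 < Complex.normSq (1 - a * b) := Complex.normSq_pos.2 (one_sub_mul_ne_zero ha hb)
  have hP : 0 < (1 - (a + b) / 2).re := by
    have h1 := Complex.re_le_norm a
    have h2 := Complex.re_le_norm b
    simp
    linarith
  have hP' : 0 < Complex.normSq (1 - (a + b) / 2) :=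
    Complex.normSq_pos.2 fun h => by rw [h] at hP; simp at hP
  have ha' : 0 < 1 - Complex.normSq a := by
    rw [Complex.normSq_eq_norm_sq]; nlinarith [norm_nonneg a]
  have hb' : 0 < 1 - Complex.normSq b := by
    rw [Complex.normSq_eq_norm_sq]; nlinarith [norm_nonneg b]
  have key : ((1 - a * b) / (1 - (a + b) / 2)).re * Complex.normSq (1 - (a + b) / 2) =
      (Complex.normSq (1 - a * b) + ((1 - Complex.normSq a) * Complex.normSq (1 - b) +
        (1 - Complex.normSq b) * Complex.normSq (1 - a)) / 2) / 2 := by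
    rw [Complex.div_re, ← add_div, div_mul_cancel₀ _ hP'.ne']
    simp [Complex.normSq_apply]
    ring
  have := Complex.normSq_nonneg (1 - a)
  have := Complex.normSq_nonneg (1 - b)
  refine pos_of_mul_pos_left (b := Complex.normSq (1 - (a + b) / 2)) ?_ hP'.le
  rw [key]
  positivity

theorem cpow_half_sq (x : ℂ) : (x ^ (1 / 2 : ℂ)) ^ 2 = x := by
  simp [← Complex.cpow_nat_mul]

/-- The Gaussian integral of `quadExp`, up to the choice of the square root of `1 - a b`. -/
theorem exists_integral_quadExp {a b : ℂ} (ha : ‖a‖ < 1) (hb : ‖b‖ < 1) :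
    ∃ κ : ℂ, κ ^ 2 * (1 - a * b) = 1 ∧ ∀ c d : ℂ, ∫ u, quadExp a b c d u ∂gaussMeasure =
      κ * Complex.exp ((b * c ^ 2 + a * d ^ 2 + 2 * c * d) / (2 * (1 - a * b))) := by
  set P := 1 - (a + b) / 2 with hP
  have hPre : 0 < P.re := by
    have h1 := Complex.re_le_norm a
    have h2 := Complex.re_le_norm b
    simp [hP]
    linarith
  have hP0 : P ≠ 0 := fun h => by rw [h] at hPre; simp at hPre
  have hD := one_sub_mul_ne_zero ha hb
  have hpi : (Real.pi : ℂ) ≠ 0 := by simp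
  have hQre := re_div_pos_of_norm_lt_one ha hb
  rw [← hP] at hQre
  set Q := (1 - a * b) / P with hQ
  have hQ0 : Q ≠ 0 := fun h => by rw [h] at hQre; simp at hQre
  -- One factor for each of the two one-dimensional Gaussian integrals. Since `P * Q = 1 - a * b`,
  -- the square is as required.
  refine ⟨1 / Real.pi * ((Real.pi / P) ^ (1 / 2 : ℂ) * (Real.pi / Q) ^ (1 / 2 : ℂ)), ?_, ?_⟩
  · rw [mul_pow, mul_pow, cpow_half_sq, cpow_half_sq, hQ]
    field_simp
  · intro c d
    have hint := integrable_volume_quadExp ha hb c d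
    -- The whole exponent in real coordinates, grouped as a quadratic in `x`, which is integrated
    -- first.
    set E : ℝ → ℝ → ℂ := fun x y => -P * x ^ 2 + (Complex.I * (a - b) * y + (c + d)) * x +
      (-(1 + (a + b) / 2) * y ^ 2 + Complex.I * (c - d) * y) with hE
    have hfun : ∀ x y : ℝ, Complex.exp (-(‖(⟨x, y⟩ : ℂ)‖ : ℂ) ^ 2) * quadExp a b c d ⟨x, y⟩ =
        Complex.exp (E x y) := by
      intro x y
      have h1 : ((‖(⟨x, y⟩ : ℂ)‖ : ℂ)) ^ 2 = x ^ 2 + y ^ 2 := by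
        rw [← Complex.ofReal_pow, ← Complex.normSq_eq_norm_sq, Complex.normSq_apply]
        push_cast
        ring
      have h2 : (⟨x, y⟩ : ℂ) = x + y * Complex.I := Complex.mk_eq_add_mul_I x y
      rw [quadExp, ← Complex.exp_add, h1, h2]
      congr 1
      simp only [map_add, map_mul, Complex.conj_ofReal, Complex.conj_I, hE, hP]
      linear_combination (a / 2 * y ^ 2 + b / 2 * y ^ 2) * Complex.I_sq
    rw [integral_gaussMeasure, mul_assoc]
    congr 1
    rw [← Complex.volume_preserving_equiv_real_prod.symm.integral_comp
      Complex.measurableEquivRealProd.symm.measurableEmbedding]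
    have hint' := (Complex.volume_preserving_equiv_real_prod.symm.integrable_comp_emb
      Complex.measurableEquivRealProd.symm.measurableEmbedding).2 hint
    have hcomp : ∀ p : ℝ × ℝ, Complex.measurableEquivRealProd.symm p = ⟨p.1, p.2⟩ := fun p => rfl
    simp only [Function.comp_def, hcomp, hfun] at hint' ⊢
    rw [Measure.volume_eq_prod] at hint' ⊢
    rw [integral_prod_symm _ hint']
    have inner : ∀ y : ℝ, ∫ x : ℝ, Complex.exp (E x y) = (Real.pi / P) ^ (1 / 2 : ℂ) *
        Complex.exp (-Q * y ^ 2 + (Complex.I * (c - d) + Complex.I * (a - b) * (c + d) / (2 * P)) * y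
          + (c + d) ^ 2 / (4 * P)) := by
      intro y
      simp only [hE]
      rw [integral_cexp_quadratic (by simpa using hPre), neg_neg]
      congr 2
      rw [hQ]
      field_simp
      rw [hP]
      linear_combination (2 * (a - b) ^ 2 * y ^ 2 : ℂ) * Complex.I_sq
    simp only [inner]
    rw [integral_const_mul, integral_cexp_quadratic (by simpa using hQre), neg_neg, ← mul_assoc]
    congr 2
    have hI : (Complex.I * (c - d) + Complex.I * (a - b) * (c + d) / (2 * P)) ^ 2 =
        -((c - d) + (a - b) * (c + d) / (2 * P)) ^ 2 := by
      linear_combination ((c - d) + (a - b) * (c + d) / (2 * P)) ^ 2 * Complex.I_sq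
    rw [hI, hQ]
    field_simp
    rw [hP]
    ring

/-! ### The reproducing formula for entire functions. -/

theorem gaussMeasure_integral_one : ∫ _ : ℂ, (1 : ℂ) ∂gaussMeasure = 1 := by
  have hp : (Real.pi : ℂ) ≠ 0 := by simp
  have h := GaussianFourier.integral_cexp_neg_mul_sq_norm (V := ℂ) (b := 1) (by simp)
  simp only [neg_mul, one_mul, div_one, Complex.finrank_real_complex] at h
  rw [integral_gaussMeasure]
  simp only [mul_one]
  rw [h]
  simp [hp]

/-- The mean value property of entire functions for the Gaussian measure. -/
theorem integral_gaussMeasure_of_differentiable {g : ℂ → ℂ} (hg : Differentiable ℂ g)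
    (hi : Integrable g gaussMeasure) : ∫ z, g z ∂gaussMeasure = g 0 := by
  have hp := Real.pi_pos
  have hc := hg.continuous
  set G : ℂ → ℂ := fun z => Complex.exp (-(‖z‖ : ℂ) ^ 2) * g z with hG
  have hGi : Integrable G := integrable_gaussMeasure_iff.1 hi
  -- Rotations preserve the integral of `G`, so it may be averaged over `θ`. After Fubini, the inner
  -- `θ`-integral is a circle mean of `g`, which is `g 0`.
  set e : ℝ → ℂ ≃ₗᵢ[ℝ] ℂ := fun θ => rotation (Circle.exp θ) with he
  have he' : ∀ θ w, e θ w = w * Complex.exp ((θ : ℝ) * Complex.I) := fun θ w => by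
    simp [he, rotation_apply, mul_comm]
  have hrot : ∀ θ, ∫ w, G (e θ w) = ∫ w, G w := fun θ =>
    (e θ).measurePreserving.integral_comp (e θ).toHomeomorph.measurableEmbedding G
  have hroti : ∀ θ, Integrable (fun w => G (e θ w)) := fun θ =>
    ((e θ).measurePreserving.integrable_comp_emb (e θ).toHomeomorph.measurableEmbedding).2 hGi
  have hrotn : ∀ θ, ∫ w, ‖G (e θ w)‖ = ∫ w, ‖G w‖ := fun θ =>
    (e θ).measurePreserving.integral_comp (e θ).toHomeomorph.measurableEmbedding fun w => ‖G w‖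
  set ν : Measure ℝ := volume.restrict (Set.Ioc 0 (2 * Real.pi)) with hν
  have hcG : Continuous fun q : ℝ × ℂ => G (e q.1 q.2) := by
    simp only [he', hG]
    fun_prop
  have hprod : Integrable (Function.uncurry fun θ w => G (e θ w)) (ν.prod volume) := by
    have hm : AEStronglyMeasurable (Function.uncurry fun θ w => G (e θ w)) (ν.prod volume) :=
      hcG.aestronglyMeasurable
    rw [integrable_prod_iff hm]
    refine ⟨Eventually.of_forall hroti, ?_⟩
    simp only [Function.uncurry, hrotn]
    exact integrable_const _
  have hswap := integral_integral_swap hprod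
  have hcirc : ∀ w, ∫ θ, G (e θ w) ∂ν = (2 * Real.pi) • (Complex.exp (-(‖w‖ : ℂ) ^ 2) * g 0) := by
    intro w
    have hd : Differentiable ℂ fun ζ : ℂ => g (w * ζ) := by fun_prop
    have h1 := DiffContOnCl.circleAverage (c := 0) (R := 1) hd.diffContOnCl
    rw [Real.circleAverage_def, intervalIntegral.integral_of_le (by positivity)] at h1
    simp only [mul_zero, circleMap_zero, Complex.ofReal_one, one_mul] at h1
    have h2 : ∀ θ, G (e θ w) =
        Complex.exp (-(‖w‖ : ℂ) ^ 2) * g (w * Complex.exp ((θ : ℝ) * Complex.I)) := fun θ => by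
      simp only [hG, LinearIsometryEquiv.norm_map]
      rw [he']
    simp only [h2]
    rw [integral_const_mul, ← h1, mul_smul_comm, smul_smul, mul_inv_cancel₀ (by positivity),
      one_smul]
  simp only [hrot, hcirc] at hswap
  rw [integral_const, integral_smul, integral_mul_const] at hswap
  have hm : ν.real Set.univ = 2 * Real.pi := by
    simp [hν, Measure.real, hp.le]
  rw [hm] at hswap
  have h3 : ∫ w, G w = (∫ w : ℂ, Complex.exp (-(‖w‖ : ℂ) ^ 2)) * g 0 :=
    smul_right_injective ℂ (by positivity : (2 * Real.pi) ≠ 0) hswap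
  have h4 := gaussMeasure_integral_one
  rw [integral_gaussMeasure] at h4 ⊢
  simp only [mul_one] at h4
  rw [h3, ← mul_assoc, h4, one_mul]

/-- The reproducing formula. -/
theorem integral_exp_mul_of_differentiable {g : ℂ → ℂ} (hg : Differentiable ℂ g) (z : ℂ)
    (hi : Integrable (fun w => Complex.exp (z * starRingEnd ℂ w) * g w) gaussMeasure) :
    ∫ w, Complex.exp (z * starRingEnd ℂ w) * g w ∂gaussMeasure = g z := by
  set F : ℂ → ℂ := fun w =>
    Complex.exp (-(‖w‖ : ℂ) ^ 2) * (Complex.exp (z * starRingEnd ℂ w) * g w) with hF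
  -- Translating by `z` cancels the antiholomorphic factor: `-|w + z|² + z conj(w + z) = -|w|² - w
  -- conj z`. What multiplies the Gaussian is then entire, and its value at 0 is `g z`.
  set h : ℂ → ℂ := fun w => Complex.exp (-w * starRingEnd ℂ z) * g (w + z) with hh
  have hhd : Differentiable ℂ h := by simp only [hh]; fun_prop
  have hFi : Integrable F := integrable_gaussMeasure_iff.1 hi
  have hFh : ∀ w, F (w + z) = Complex.exp (-(‖w‖ : ℂ) ^ 2) * h w := by
    intro w
    simp only [hF, hh, ← mul_assoc, ← Complex.exp_add]
    congr 2
    rw [← Complex.mul_conj', ← Complex.mul_conj', map_add]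
    ring
  have hhi : Integrable h gaussMeasure := by
    rw [integrable_gaussMeasure_iff]
    simpa only [hFh] using hFi.comp_add_right z
  have h1 := integral_gaussMeasure_of_differentiable hhd hhi
  have h2 : h 0 = g z := by simp [hh]
  rw [← h2, ← h1, integral_gaussMeasure, integral_gaussMeasure]
  simp only [← hFh]
  rw [integral_add_right_eq_self F z]

/-! ### Elements of the Fock space and its reproducing vectors. -/

/-- Turns inner products of holomorphic Gaussians into integrals of a single `quadExp`. -/
theorem conj_quadExp_mul (p q p' q' w : ℂ) :
    starRingEnd ℂ (quadExp p 0 q 0 w) * quadExp p' 0 q' 0 w =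
      quadExp p' (starRingEnd ℂ p) q' (starRingEnd ℂ q) w := by
  rw [quadExp, quadExp, quadExp, ← Complex.exp_conj, ← Complex.exp_add]
  congr 1
  simp only [map_add, map_mul, map_div₀, map_pow, map_zero, map_ofNat]
  ring

theorem memLp_quadExp {p : ℂ} (hp : ‖p‖ < 1) (q : ℂ) :
    MemLp (quadExp p 0 q 0) 2 gaussMeasure := by
  have hc : Continuous (quadExp p 0 q 0) := by unfold quadExp; fun_prop
  rw [memLp_two_iff_integrable_sq_norm hc.aestronglyMeasurable]
  have h := (integrable_quadExp hp (b := starRingEnd ℂ p) (by simpa using hp) q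
    (starRingEnd ℂ q)).norm
  refine h.congr (Eventually.of_forall fun w => ?_)
  simp only
  rw [← conj_quadExp_mul, norm_mul, RCLike.norm_conj, sq]

theorem differentiable_quadExp (p q : ℂ) : Differentiable ℂ (quadExp p 0 q 0) := by
  unfold quadExp
  simp only [zero_mul, zero_div, add_zero]
  fun_prop

/-- A shortcut, so that `inner` is not found through `CStarModule`. -/
local instance : Inner ℂ fockSpace := InnerProductSpace.toInner

/-- The element of the Fock space given by a square integrable entire function. -/
def fockMk (g : ℂ → ℂ) (hg : Differentiable ℂ g) (hm : MemLp g 2 gaussMeasure) : fockSpace :=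
  ⟨hm.toLp g, g, hg, hm.coeFn_toLp⟩

theorem coeFn_fockMk (g : ℂ → ℂ) (hg : Differentiable ℂ g) (hm : MemLp g 2 gaussMeasure) :
    (fockMk g hg hm : Lp ℂ 2 gaussMeasure) =ᵐ[gaussMeasure] g := hm.coeFn_toLp

theorem inner_fockMk_left (g : ℂ → ℂ) (hg : Differentiable ℂ g) (hm : MemLp g 2 gaussMeasure)
    (f : fockSpace) :
    Integrable (fun w => starRingEnd ℂ (g w) * (f : Lp ℂ 2 gaussMeasure) w) gaussMeasure ∧
    inner ℂ (fockMk g hg hm) f =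
      ∫ w, starRingEnd ℂ (g w) * (f : Lp ℂ 2 gaussMeasure) w ∂gaussMeasure := by
  have hae : (fun w => inner ℂ ((fockMk g hg hm : Lp ℂ 2 gaussMeasure) w)
      ((f : Lp ℂ 2 gaussMeasure) w)) =ᵐ[gaussMeasure]
      fun w => starRingEnd ℂ (g w) * (f : Lp ℂ 2 gaussMeasure) w := by
    filter_upwards [coeFn_fockMk g hg hm] with w hw
    rw [hw, RCLike.inner_apply, mul_comm]
  refine ⟨(L2.integrable_inner (𝕜 := ℂ) (fockMk g hg hm : Lp ℂ 2 gaussMeasure)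
    (f : Lp ℂ 2 gaussMeasure)).congr hae, ?_⟩
  rw [Submodule.coe_inner, L2.inner_def]
  exact integral_congr_ae hae

/-- The reproducing vector at `a`, i.e. the entire function `w ↦ exp(w conj(a))`. -/
def fockExp (a : ℂ) : fockSpace :=
  fockMk (quadExp 0 0 (starRingEnd ℂ a) 0) (differentiable_quadExp _ _)
    (memLp_quadExp (by simp) _)

/-- The integrability that the reproducing formula requires comes from the pairing of two `L²`
functions. -/
theorem inner_fockExp {f : fockSpace} {g : ℂ → ℂ} (hg : Differentiable ℂ g)
    (hfg : (f : Lp ℂ 2 gaussMeasure) =ᵐ[gaussMeasure] g) (z : ℂ) :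
    inner ℂ (fockExp z) f = g z := by
  obtain ⟨h1, h2⟩ := inner_fockMk_left (quadExp 0 0 (starRingEnd ℂ z) 0)
    (differentiable_quadExp _ _) (memLp_quadExp (by simp) _) f
  have hq : ∀ w, starRingEnd ℂ (quadExp 0 0 (starRingEnd ℂ z) 0 w) =
      Complex.exp (z * starRingEnd ℂ w) := fun w => by
    rw [quadExp, ← Complex.exp_conj]
    simp
  simp only [hq] at h1 h2
  have hae : (fun w => Complex.exp (z * starRingEnd ℂ w) * (f : Lp ℂ 2 gaussMeasure) w)
      =ᵐ[gaussMeasure] fun w => Complex.exp (z * starRingEnd ℂ w) * g w := by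
    filter_upwards [hfg] with w hw
    rw [hw]
  rw [fockExp, h2, integral_congr_ae hae]
  exact integral_exp_mul_of_differentiable hg z (h1.congr hae)

theorem inner_fockExp_fockMk (g : ℂ → ℂ) (hg : Differentiable ℂ g)
    (hm : MemLp g 2 gaussMeasure) (z : ℂ) : inner ℂ (fockExp z) (fockMk g hg hm) = g z :=
  inner_fockExp hg (coeFn_fockMk g hg hm) z

/-- Provides a canonical entire representative of each class, so none has to be chosen. -/
theorem coeFn_eq_inner_fockExp (f : fockSpace) :
    (Differentiable ℂ fun z => inner ℂ (fockExp z) f) ∧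
    (f : Lp ℂ 2 gaussMeasure) =ᵐ[gaussMeasure] fun z => inner ℂ (fockExp z) f := by
  obtain ⟨g, hg, hfg⟩ := f.2
  have : (fun z => inner ℂ (fockExp z) f) = g := funext (inner_fockExp hg hfg)
  rw [this]
  exact ⟨hg, hfg⟩

theorem fockSpace_ext {f g : fockSpace}
    (h : ∀ z, inner ℂ (fockExp z) f = inner ℂ (fockExp z) g) : f = g := by
  apply Subtype.ext
  apply Lp.ext
  refine (coeFn_eq_inner_fockExp f).2.trans (EventuallyEq.trans ?_ (coeFn_eq_inner_fockExp g).2.symm)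
  exact Eventually.of_forall h

/-- A vector orthogonal to every `fockExp z` has an entire representative vanishing at every `z`. -/
theorem dense_span_fockExp :
    Dense (Submodule.span ℂ (Set.range fockExp) : Set fockSpace) := by
  rw [Submodule.dense_iff_topologicalClosure_eq_top, Submodule.topologicalClosure_eq_top_iff,
    eq_bot_iff]
  intro f hf
  rw [Submodule.mem_bot]
  refine fockSpace_ext fun z => ?_
  rw [inner_zero_right]
  exact (Submodule.mem_orthogonal _ _).1 hf _ (Submodule.subset_span ⟨z, rfl⟩)

/-! ### The kernel as a Fock space vector in each variable. -/

theorem sqrt_sq (s : ℂ) : Complex.sqrt s ^ 2 = s := by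
  rw [Complex.sqrt, ← one_div, cpow_half_sq]

theorem sqrt_ne_zero {s : ℂ} (hs : s ≠ 0) : Complex.sqrt s ≠ 0 := fun h => hs (by
  rw [← sqrt_sq s, h]; simp)

theorem fst_ne_zero_of_pairDet {p : ℂ × ℂ} (hp : pairDet p = 1) : p.1 ≠ 0 := fun h => by
  have := Complex.normSq_nonneg p.2
  rw [pairDet, h, map_zero] at hp
  linarith

theorem conj_fst_mul_fst_of_pairDet {p : ℂ × ℂ} (hp : pairDet p = 1) :
    starRingEnd ℂ p.1 * p.1 = 1 + starRingEnd ℂ p.2 * p.2 := by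
  rw [← Complex.normSq_eq_conj_mul_self, ← Complex.normSq_eq_conj_mul_self,
    ← Complex.ofReal_one, ← Complex.ofReal_add, Complex.ofReal_inj]
  rw [pairDet] at hp
  linarith

theorem norm_snd_div_fst_lt_one {p : ℂ × ℂ} (hp : pairDet p = 1) : ‖p.2 / p.1‖ < 1 := by
  have h0 := norm_pos_iff.2 (fst_ne_zero_of_pairDet hp)
  rw [norm_div, div_lt_one h0]
  rw [pairDet, Complex.normSq_eq_norm_sq, Complex.normSq_eq_norm_sq] at hp
  exact lt_of_pow_lt_pow_left₀ 2 h0.le (by linarith)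

theorem norm_neg_snd_div_conj_fst_lt_one {p : ℂ × ℂ} (hp : pairDet p = 1) :
    ‖-p.2 / starRingEnd ℂ p.1‖ < 1 := by
  have := norm_snd_div_fst_lt_one hp
  rw [norm_div] at this ⊢
  rwa [norm_neg, RCLike.norm_conj]

/-- Isolates `z`: a constant times a holomorphic Gaussian with quadratic coefficient `t / s`, which
has norm below 1 on `SL(ℂ × ℂ)`. -/
theorem fockKernel_eq_right {s : ℂ} (hs : s ≠ 0) (t z a : ℂ) :
    fockKernel s t z a =
      1 / Complex.sqrt s * Complex.exp (-starRingEnd ℂ (t * a ^ 2) / (2 * s)) *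
        quadExp (t / s) 0 (starRingEnd ℂ a / s) 0 z := by
  rw [fockKernel, quadExp, mul_assoc (1 / Complex.sqrt s), ← Complex.exp_add]
  congr 2
  field_simp
  ring

theorem conj_fockKernel_eq_left {s : ℂ} (hs : s ≠ 0) (t z w : ℂ) :
    starRingEnd ℂ (fockKernel s t z w) =
      starRingEnd ℂ (1 / Complex.sqrt s * Complex.exp (t * z ^ 2 / (2 * s))) *
        quadExp (-t / starRingEnd ℂ s) 0 (starRingEnd ℂ z / starRingEnd ℂ s) 0 w := by
  have hs' : starRingEnd ℂ s ≠ 0 := (map_ne_zero _).2 hs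
  rw [fockKernel, quadExp, map_mul _ (1 / Complex.sqrt s), map_mul _ (1 / Complex.sqrt s),
    mul_assoc (starRingEnd ℂ (1 / Complex.sqrt s)), ← Complex.exp_conj, ← Complex.exp_conj,
    ← Complex.exp_add]
  congr 2
  simp only [map_add, map_sub, map_mul, map_div₀, map_pow, map_ofNat, Complex.conj_conj]
  field_simp
  ring

theorem fockKernel_mul_fockKernel {s₁ s₂ : ℂ} (h₁ : s₁ ≠ 0) (h₂ : s₂ ≠ 0) (t₁ t₂ z u a : ℂ) :
    fockKernel s₁ t₁ z u * fockKernel s₂ t₂ u a =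
      1 / (Complex.sqrt s₁ * Complex.sqrt s₂) * Complex.exp (t₁ * z ^ 2 / (2 * s₁) -
        starRingEnd ℂ (t₂ * a ^ 2) / (2 * s₂)) *
        quadExp (t₂ / s₂) (-starRingEnd ℂ t₁ / s₁) (starRingEnd ℂ a / s₂) (z / s₁) u := by
  rw [fockKernel, fockKernel, quadExp, mul_mul_mul_comm, ← Complex.exp_add, one_div_mul_one_div,
    mul_assoc (1 / (Complex.sqrt s₁ * Complex.sqrt s₂)), ← Complex.exp_add]
  congr 2
  simp only [map_mul, map_pow]
  field_simp
  ring

theorem differentiable_fockKernel_right {p : ℂ × ℂ} (hp : pairDet p = 1) (a : ℂ) :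
    Differentiable ℂ fun z => fockKernel p.1 p.2 z a := by
  simp only [fockKernel_eq_right (fst_ne_zero_of_pairDet hp)]
  exact (differentiable_quadExp _ _).const_mul _

theorem memLp_fockKernel_right {p : ℂ × ℂ} (hp : pairDet p = 1) (a : ℂ) :
    MemLp (fun z => fockKernel p.1 p.2 z a) 2 gaussMeasure := by
  simp only [fockKernel_eq_right (fst_ne_zero_of_pairDet hp)]
  exact (memLp_quadExp (norm_snd_div_fst_lt_one hp) _).const_mul _

theorem differentiable_conj_fockKernel_left {p : ℂ × ℂ} (hp : pairDet p = 1) (z : ℂ) :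
    Differentiable ℂ fun w => starRingEnd ℂ (fockKernel p.1 p.2 z w) := by
  simp only [conj_fockKernel_eq_left (fst_ne_zero_of_pairDet hp)]
  exact (differentiable_quadExp _ _).const_mul _

theorem memLp_conj_fockKernel_left {p : ℂ × ℂ} (hp : pairDet p = 1) (z : ℂ) :
    MemLp (fun w => starRingEnd ℂ (fockKernel p.1 p.2 z w)) 2 gaussMeasure := by
  simp only [conj_fockKernel_eq_left (fst_ne_zero_of_pairDet hp)]
  exact (memLp_quadExp (norm_neg_snd_div_conj_fst_lt_one hp) _).const_mul _

/-- The entire function `z ↦ K(z, a)` as an element of the Fock space. -/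
def fockKernelRight (p : ℂ × ℂ) (hp : pairDet p = 1) (a : ℂ) : fockSpace :=
  fockMk _ (differentiable_fockKernel_right hp a) (memLp_fockKernel_right hp a)

/-- The entire function `w ↦ conj K(z, w)` as an element of the Fock space. -/
def fockKernelLeft (p : ℂ × ℂ) (hp : pairDet p = 1) (z : ℂ) : fockSpace :=
  fockMk _ (differentiable_conj_fockKernel_left hp z) (memLp_conj_fockKernel_left hp z)

theorem inner_fockMk_fockMk (g g' : ℂ → ℂ) (hg : Differentiable ℂ g)
    (hm : MemLp g 2 gaussMeasure) (hg' : Differentiable ℂ g') (hm' : MemLp g' 2 gaussMeasure) :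
    inner ℂ (fockMk g hg hm) (fockMk g' hg' hm') =
      ∫ w, starRingEnd ℂ (g w) * g' w ∂gaussMeasure := by
  rw [(inner_fockMk_left g hg hm _).2]
  refine integral_congr_ae ?_
  filter_upwards [coeFn_fockMk g' hg' hm'] with w hw
  rw [hw]

/-- The defining integral is an `L²` pairing with a fixed vector, hence converges absolutely. -/
theorem inner_fockKernelLeft (p : ℂ × ℂ) (hp : pairDet p = 1) (z : ℂ) (f : fockSpace) :
    Integrable (fun w => fockKernel p.1 p.2 z w * (f : Lp ℂ 2 gaussMeasure) w) gaussMeasure ∧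
    inner ℂ (fockKernelLeft p hp z) f =
      fockTransform p.1 p.2 (f : Lp ℂ 2 gaussMeasure) z := by
  have h := inner_fockMk_left _ (differentiable_conj_fockKernel_left hp z)
    (memLp_conj_fockKernel_left hp z) f
  simp only [Complex.conj_conj] at h
  exact ⟨h.1, h.2⟩

theorem inner_fockKernelLeft_fockExp (p : ℂ × ℂ) (hp : pairDet p = 1) (z a : ℂ) :
    inner ℂ (fockKernelLeft p hp z) (fockExp a) = fockKernel p.1 p.2 z a := by
  rw [← inner_conj_symm, fockKernelLeft, inner_fockExp_fockMk, Complex.conj_conj]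

theorem inner_fockExp_fockKernelRight (p : ℂ × ℂ) (hp : pairDet p = 1) (z a : ℂ) :
    inner ℂ (fockExp z) (fockKernelRight p hp a) = fockKernel p.1 p.2 z a := by
  rw [fockKernelRight, inner_fockExp_fockMk]

/-! ### The isometry on reproducing vectors. -/

/-- For conjugate coefficients and `c = d = 0` the integrand is the positive function `exp(Re(a
u²))`. This settles the sign of the square root that `exists_integral_quadExp` leaves open. -/
theorem exists_integral_quadExp_conj {a : ℂ} (ha : ‖a‖ < 1) :
    ∃ r : ℝ, 0 ≤ r ∧ r ^ 2 * (1 - ‖a‖ ^ 2) = 1 ∧ ∀ c d : ℂ,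
      ∫ u, quadExp a (starRingEnd ℂ a) c d u ∂gaussMeasure =
      r * Complex.exp ((starRingEnd ℂ a * c ^ 2 + a * d ^ 2 + 2 * c * d) /
        (2 * (1 - a * starRingEnd ℂ a))) := by
  obtain ⟨κ, h1, h2⟩ := exists_integral_quadExp ha (b := starRingEnd ℂ a) (by simpa using ha)
  have h3 := h2 0 0
  have h4 : ∀ u, quadExp a (starRingEnd ℂ a) 0 0 u = (Real.exp (a * u ^ 2).re : ℝ) := fun u => by
    rw [quadExp, Complex.ofReal_exp, Complex.re_eq_add_conj]
    simp only [map_mul, map_pow]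
    congr 1
    ring
  simp only [h4, integral_complex_ofReal] at h3
  simp only [ne_eq, OfNat.ofNat_ne_zero, not_false_eq_true, zero_pow, mul_zero, add_zero, zero_div,
    Complex.exp_zero, mul_one] at h3
  rw [← h3] at h1 h2
  refine ⟨_, integral_nonneg fun u => (Real.exp_pos _).le, ?_, h2⟩
  rw [Complex.mul_conj'] at h1
  exact_mod_cast h1

/-- From `|s|² - |t|² = 1` one gets `1 - |t/s|² = 1/|s|²`, so the Gaussian prefactor is `|s|` and
cancels the two factors `s^{-1/2}` exactly. The terms in `conj(b)²` and `a²` cancel in the exponent,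
leaving `a conj b`. -/
theorem inner_fockKernelRight (p : ℂ × ℂ) (hp : pairDet p = 1) (a b : ℂ) :
    inner ℂ (fockKernelRight p hp a) (fockKernelRight p hp b) =
      inner ℂ (fockExp a) (fockExp b) := by
  have hs := fst_ne_zero_of_pairDet hp
  have hs' : starRingEnd ℂ p.1 ≠ 0 := (map_ne_zero _).2 hs
  have hdet := conj_fst_mul_fst_of_pairDet hp
  obtain ⟨r, hr0, hr, hint⟩ := exists_integral_quadExp_conj (norm_snd_div_fst_lt_one hp)
  have hn : 0 < ‖p.1‖ := norm_pos_iff.2 hs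
  have hr' : r = ‖p.1‖ := by
    have h1 : 1 - ‖p.2 / p.1‖ ^ 2 = 1 / ‖p.1‖ ^ 2 := by
      rw [pairDet, Complex.normSq_eq_norm_sq, Complex.normSq_eq_norm_sq] at hp
      rw [norm_div]
      field_simp
      linarith
    rw [h1] at hr
    field_simp at hr
    exact (sq_eq_sq₀ hr0 hn.le).1 hr
  have hD : 1 - p.2 / p.1 * starRingEnd ℂ (p.2 / p.1) = 1 / (starRingEnd ℂ p.1 * p.1) := by
    rw [map_div₀]
    field_simp
    linear_combination hdet
  have hsq : starRingEnd ℂ (1 / Complex.sqrt p.1) * (1 / Complex.sqrt p.1) * r = 1 := by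
    rw [mul_comm (starRingEnd ℂ _), Complex.mul_conj', hr', norm_div, norm_one]
    have : ‖Complex.sqrt p.1‖ ^ 2 = ‖p.1‖ := by rw [← norm_pow, sqrt_sq]
    rw [← Complex.ofReal_pow, div_pow, this, one_pow, ← Complex.ofReal_mul,
      one_div_mul_cancel hn.ne', Complex.ofReal_one]
  have hexp : inner ℂ (fockExp a) (fockExp b) = Complex.exp (a * starRingEnd ℂ b) := by
    rw [fockExp.eq_def b, inner_fockExp_fockMk, quadExp]
    congr 1
    ring
  rw [hexp, fockKernelRight, fockKernelRight, inner_fockMk_fockMk]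
  simp only [fockKernel_eq_right hs]
  have hfun : ∀ w,
      starRingEnd ℂ (1 / Complex.sqrt p.1 * Complex.exp (-starRingEnd ℂ (p.2 * a ^ 2) / (2 * p.1)) *
        quadExp (p.2 / p.1) 0 (starRingEnd ℂ a / p.1) 0 w) *
      (1 / Complex.sqrt p.1 * Complex.exp (-starRingEnd ℂ (p.2 * b ^ 2) / (2 * p.1)) *
        quadExp (p.2 / p.1) 0 (starRingEnd ℂ b / p.1) 0 w) =
      (starRingEnd ℂ (1 / Complex.sqrt p.1) * (1 / Complex.sqrt p.1) *
        Complex.exp (-(p.2 * a ^ 2) / (2 * starRingEnd ℂ p.1) -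
          starRingEnd ℂ (p.2 * b ^ 2) / (2 * p.1))) *
        quadExp (p.2 / p.1) (starRingEnd ℂ (p.2 / p.1)) (starRingEnd ℂ b / p.1)
          (starRingEnd ℂ (starRingEnd ℂ a / p.1)) w := fun w => by
    have he : starRingEnd ℂ (Complex.exp (-starRingEnd ℂ (p.2 * a ^ 2) / (2 * p.1))) =
        Complex.exp (-(p.2 * a ^ 2) / (2 * starRingEnd ℂ p.1)) := by
      rw [← Complex.exp_conj]
      simp only [map_div₀, map_neg, Complex.conj_conj, map_mul, map_ofNat]
    rw [← conj_quadExp_mul, sub_eq_add_neg, Complex.exp_add, map_mul (starRingEnd ℂ) (_ * _) _,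
      map_mul (starRingEnd ℂ) (1 / _) _, he, ← neg_div]
    ring
  simp only [hfun]
  rw [integral_const_mul, hint, hD]
  have hre : ∀ x y : ℂ, starRingEnd ℂ (1 / Complex.sqrt p.1) * (1 / Complex.sqrt p.1) *
      Complex.exp x * (r * Complex.exp y) =
      starRingEnd ℂ (1 / Complex.sqrt p.1) * (1 / Complex.sqrt p.1) * r *
        Complex.exp (x + y) := fun x y => by
    rw [Complex.exp_add]; ring
  rw [hre, hsq, one_mul]
  congr 1
  simp only [map_mul, map_div₀, map_pow, Complex.conj_conj]
  field_simp
  ring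

/-- Both families have the same Gram matrix. -/
theorem norm_linearCombination_fockKernelRight (p : ℂ × ℂ) (hp : pairDet p = 1) (v : ℂ →₀ ℂ) :
    ‖Finsupp.linearCombination ℂ (fockKernelRight p hp) v‖ =
      ‖Finsupp.linearCombination ℂ fockExp v‖ := by
  have h : inner ℂ (Finsupp.linearCombination ℂ (fockKernelRight p hp) v)
      (Finsupp.linearCombination ℂ (fockKernelRight p hp) v) =
      inner ℂ (Finsupp.linearCombination ℂ fockExp v) (Finsupp.linearCombination ℂ fockExp v) := by
    simp only [Finsupp.linearCombination_apply, Finsupp.sum, sum_inner, inner_sum, inner_smul_left,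
      inner_smul_right, inner_fockKernelRight]
  rw [inner_self_eq_norm_sq_to_K, inner_self_eq_norm_sq_to_K] at h
  have h' : ‖Finsupp.linearCombination ℂ (fockKernelRight p hp) v‖ ^ 2 =
      ‖Finsupp.linearCombination ℂ fockExp v‖ ^ 2 := by exact_mod_cast h
  exact (sq_eq_sq₀ (norm_nonneg _) (norm_nonneg _)).1 h'

/-! ### The operator and its integral formula. -/

theorem denseRange_linearCombination_fockExp :
    DenseRange (Finsupp.linearCombination ℂ fockExp) := by
  have := dense_span_fockExp
  rwa [← Finsupp.range_linearCombination, LinearMap.coe_range] at this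

/-- The bounded operator on the Fock space with kernel `K^{(s,t)}`. -/
def fockOp (p : ℂ × ℂ) (hp : pairDet p = 1) : fockSpace →L[ℂ] fockSpace :=
  (Finsupp.linearCombination ℂ (fockKernelRight p hp)).extendOfNorm
    (Finsupp.linearCombination ℂ fockExp)

theorem fockOp_linearCombination (p : ℂ × ℂ) (hp : pairDet p = 1) (v : ℂ →₀ ℂ) :
    fockOp p hp (Finsupp.linearCombination ℂ fockExp v) =
      Finsupp.linearCombination ℂ (fockKernelRight p hp) v :=
  LinearMap.extendOfNorm_eq denseRange_linearCombination_fockExp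
    -- The isometry identity supplies the bound with constant 1.
    ⟨1, fun x => by rw [one_mul, norm_linearCombination_fockKernelRight]⟩ v

theorem fockOp_fockExp (p : ℂ × ℂ) (hp : pairDet p = 1) (a : ℂ) :
    fockOp p hp (fockExp a) = fockKernelRight p hp a := by
  simpa using fockOp_linearCombination p hp (Finsupp.single a 1)

theorem norm_fockOp (p : ℂ × ℂ) (hp : pairDet p = 1) (f : fockSpace) :
    ‖fockOp p hp f‖ = ‖f‖ := by
  refine denseRange_linearCombination_fockExp.induction_on f
    (isClosed_eq (by fun_prop) (by fun_prop)) fun v => ?_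
  rw [fockOp_linearCombination, norm_linearCombination_fockKernelRight]

/-- Two continuous functionals of `f` that both take the value `K(z, a)` at `fockExp a`. This ties
the abstract extension to the integral. -/
theorem inner_fockExp_fockOp (p : ℂ × ℂ) (hp : pairDet p = 1) (z : ℂ) (f : fockSpace) :
    inner ℂ (fockExp z) (fockOp p hp f) = inner ℂ (fockKernelLeft p hp z) f := by
  have h : (innerSL ℂ (fockExp z)).comp (fockOp p hp) = innerSL ℂ (fockKernelLeft p hp z) := by
    refine ContinuousLinearMap.ext_on dense_span_fockExp ?_
    rintro _ ⟨a, rfl⟩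
    simp only [ContinuousLinearMap.comp_apply, innerSL_apply_apply]
    rw [fockOp_fockExp, inner_fockExp_fockKernelRight, inner_fockKernelLeft_fockExp]
  exact DFunLike.congr_fun h f

theorem fockTransform_eq_inner (p : ℂ × ℂ) (hp : pairDet p = 1) (f : fockSpace) :
    fockTransform p.1 p.2 (f : Lp ℂ 2 gaussMeasure) =
      fun z => inner ℂ (fockExp z) (fockOp p hp f) := by
  funext z
  rw [inner_fockExp_fockOp, (inner_fockKernelLeft p hp z f).2]

/-! ### Composition up to sign, and unitarity. -/

/-- At `(1, 0)` the kernel is the reproducing kernel `exp(z conj w)`. -/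
theorem fockOp_one (h : pairDet (1, 0) = 1) : fockOp (1, 0) h = 1 := by
  refine ContinuousLinearMap.ext_on dense_span_fockExp ?_
  rintro _ ⟨a, rfl⟩
  rw [fockOp_fockExp, one_apply_eq_self]
  refine fockSpace_ext fun z => ?_
  rw [inner_fockExp_fockKernelRight, fockExp.eq_def a, inner_fockExp_fockMk, fockKernel, quadExp]
  simp only [Complex.sqrt_one, div_one, one_mul, zero_mul, map_zero, sub_zero, zero_add, mul_one,
    zero_div, add_zero]
  congr 1
  ring

/-- The composition of two kernels is a kernel, up to a sign. -/
theorem exists_sign_fockKernel_pairMul (p q : ℂ × ℂ) (hp : pairDet p = 1) (hq : pairDet q = 1) :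
    ∃ ε : ℂ, (ε = 1 ∨ ε = -1) ∧ ∀ z a, fockKernel (pairMul p q).1 (pairMul p q).2 z a =
      ε * ∫ u, fockKernel p.1 p.2 z u * fockKernel q.1 q.2 u a ∂gaussMeasure := by
  have hpq : pairDet (pairMul p q) = 1 := by rw [pairDet_mul, hp, hq, one_mul]
  have h1 := fst_ne_zero_of_pairDet hp
  have h2 := fst_ne_zero_of_pairDet hq
  have h3 := fst_ne_zero_of_pairDet hpq
  have d1 := conj_fst_mul_fst_of_pairDet hp
  have d2 := conj_fst_mul_fst_of_pairDet hq
  have hn : ‖-starRingEnd ℂ p.2 / p.1‖ < 1 := by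
    have := norm_snd_div_fst_lt_one hp
    rw [norm_div] at this ⊢
    rwa [norm_neg, RCLike.norm_conj]
  obtain ⟨κ, hκ, hint⟩ := exists_integral_quadExp (norm_snd_div_fst_lt_one hq) hn
  set s := (pairMul p q).1 with hs
  have hs' : s = p.1 * q.1 + starRingEnd ℂ p.2 * q.2 := rfl
  have ht' : (pairMul p q).2 = p.2 * q.1 + starRingEnd ℂ p.1 * q.2 := rfl
  have hD : 1 - q.2 / q.1 * (-starRingEnd ℂ p.2 / p.1) = s / (p.1 * q.1) := by
    rw [hs']
    field_simp
    ring
  rw [hD] at hκ hint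
  have hκ0 : κ ≠ 0 := fun h => by simp [h] at hκ
  have r1 := sqrt_ne_zero h1
  have r2 := sqrt_ne_zero h2
  have r3 := sqrt_ne_zero h3
  -- The quotient of the two prefactors. It is independent of `z` and `a`, and its square is `p.1 *
  -- q.1 / (s * κ²) = 1` by `hκ`, so only the choice of branches is left.
  refine ⟨Complex.sqrt p.1 * Complex.sqrt q.1 / (Complex.sqrt s * κ), ?_, fun z a => ?_⟩
  · rw [← sq_eq_one_iff, div_pow, mul_pow, mul_pow, sqrt_sq, sqrt_sq, sqrt_sq]
    field_simp at hκ ⊢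
    linear_combination -hκ
  · simp only [fockKernel_mul_fockKernel h1 h2]
    rw [integral_const_mul, hint, fockKernel]
    have hre : ∀ x y : ℂ, Complex.sqrt p.1 * Complex.sqrt q.1 / (Complex.sqrt s * κ) *
        (1 / (Complex.sqrt p.1 * Complex.sqrt q.1) * Complex.exp x * (κ * Complex.exp y)) =
        1 / Complex.sqrt s * Complex.exp (x + y) := fun x y => by
      rw [Complex.exp_add]
      field_simp
    rw [hre]
    congr 2
    -- The determinant conditions remove `conj p.1` and `conj q.1`, which do not occur in the
    -- exponent of the composed kernel.
    have e1 : (pairMul p q).2 * p.1 = p.2 * s + q.2 := by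
      rw [ht', hs']
      linear_combination q.2 * d1
    have e2 : starRingEnd ℂ (pairMul p q).2 * q.1 =
        starRingEnd ℂ q.2 * s + starRingEnd ℂ p.2 := by
      rw [ht', hs']
      simp only [map_add, map_mul, Complex.conj_conj]
      linear_combination starRingEnd ℂ p.2 * d2
    have e1' : (pairMul p q).2 = (p.2 * s + q.2) / p.1 := by
      rw [← e1, mul_div_cancel_right₀ _ h1]
    have e2' : starRingEnd ℂ (pairMul p q).2 =
        (starRingEnd ℂ q.2 * s + starRingEnd ℂ p.2) / q.1 := by
      rw [← e2, mul_div_cancel_right₀ _ h2]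
    simp only [map_mul, map_pow]
    rw [e2', e1']
    field_simp
    ring

/-- Tested on `fockExp a` against `fockExp z`, the operator identity is the kernel identity, with
one sign for all `z` and `a`. -/
theorem exists_sign_fockOp_pairMul (p q : ℂ × ℂ) (hp : pairDet p = 1) (hq : pairDet q = 1)
    (hpq : pairDet (pairMul p q) = 1) :
    ∃ ε : ℂ, (ε = 1 ∨ ε = -1) ∧
      fockOp (pairMul p q) hpq = ε • (fockOp p hp * fockOp q hq) := by
  obtain ⟨ε, hε, h⟩ := exists_sign_fockKernel_pairMul p q hp hq
  refine ⟨ε, hε, ContinuousLinearMap.ext_on dense_span_fockExp ?_⟩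
  rintro _ ⟨a, rfl⟩
  refine fockSpace_ext fun z => ?_
  rw [fockOp_fockExp, inner_fockExp_fockKernelRight, smul_apply,
    inner_smul_right, mul_apply_eq_comp, inner_fockExp_fockOp, fockOp_fockExp,
    fockKernelLeft, fockKernelRight, inner_fockMk_fockMk]
  simp only [Complex.conj_conj]
  exact h z a

theorem mem_unitary_of_norm_of_surjective {H : Type*} [NormedAddCommGroup H]
    [InnerProductSpace ℂ H] [CompleteSpace H] {U : H →L[ℂ] H} (hn : ∀ f, ‖U f‖ = ‖f‖)
    (hs : Function.Surjective U) : U ∈ unitary (H →L[ℂ] H) := by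
  have h1 : star U * U = 1 := (ContinuousLinearMap.norm_map_iff_adjoint_comp_self U).1 hn
  refine Unitary.mem_iff.2 ⟨h1, ContinuousLinearMap.ext fun y => ?_⟩
  obtain ⟨x, rfl⟩ := hs y
  have := DFunLike.congr_fun h1 x
  simp only [mul_apply_eq_comp, one_apply_eq_self] at this ⊢
  rw [this]

/-- The projective representation of `SL(ℂ × ℂ)` on the Fock space. -/
def fockRep (x : SLCCSubgroup) : fockSpace →L[ℂ] fockSpace :=
  fockOp (x : GLCC) x.2

theorem exists_sign_fockRep_mul (x y : SLCCSubgroup) :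
    ∃ ε : ℂ, (ε = 1 ∨ ε = -1) ∧ fockRep (x * y) = ε • (fockRep x * fockRep y) :=
  exists_sign_fockOp_pairMul _ _ x.2 y.2 (x * y).2

theorem fockRep_one : fockRep 1 = 1 := fockOp_one (1 : SLCCSubgroup).2

/-- The operator of `x⁻¹` is a right inverse up to sign. -/
theorem fockRep_surjective (x : SLCCSubgroup) : Function.Surjective (fockRep x) := by
  intro f
  obtain ⟨ε, -, h⟩ := exists_sign_fockRep_mul x x⁻¹
  rw [mul_inv_cancel, fockRep_one] at h
  refine ⟨ε • fockRep x⁻¹ f, ?_⟩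
  rw [map_smul]
  exact (DFunLike.congr_fun h f).symm

theorem isUnitaryProjectiveRep_fockRep : IsUnitaryProjectiveRep fockRep where
  unitary_apply x := mem_unitary_of_norm_of_surjective (norm_fockOp _ x.2) (fockRep_surjective x)
  map_mul x y := by
    obtain ⟨ε, hε, h⟩ := exists_sign_fockRep_mul x y
    exact ⟨ε, by rcases hε with rfl | rfl <;> simp, h⟩

end

theorem theoremB :
    -- `GL(ℂ × ℂ)` is a group under the stated product
    ∃ _ : Group GLCC, (∀ x y : GLCC, ((x * y : GLCC) : ℂ × ℂ) = pairMul x y) ∧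
      -- `SL(ℂ × ℂ)` is a subgroup `S` of it
      ∃ S : Subgroup GLCC, (Subtype.val '' (S : Set GLCC) : Set (ℂ × ℂ)) = SLCC ∧
        -- the explicit map is a group isomorphism that sends `SL(2, ℝ)` onto `SL(ℂ × ℂ)`
        (∃ φ : GL (Fin 2) ℝ ≃* GLCC,
          (∀ A : GL (Fin 2) ℝ,
            (φ A : ℂ × ℂ) = matrixToPair (A : Matrix (Fin 2) (Fin 2) ℝ)) ∧
          φ '' {A : GL (Fin 2) ℝ | (A : Matrix (Fin 2) (Fin 2) ℝ).det = 1} = (S : Set GLCC)) ∧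
        -- the integral operators are well defined on the Fock space and form a unitary
        -- projective representation of `SL(ℂ × ℂ)` with multiplier `±1`
        ∃ T : S → fockSpace →L[ℂ] fockSpace,
          (∀ (x : S) (f : fockSpace),
            (∀ z : ℂ, Integrable
              (fun w => fockKernel (x : ℂ × ℂ).1 (x : ℂ × ℂ).2 z w *
                (f : Lp ℂ 2 gaussMeasure) w) gaussMeasure) ∧
            Differentiable ℂ (fockTransform (x : ℂ × ℂ).1 (x : ℂ × ℂ).2
              (f : Lp ℂ 2 gaussMeasure)) ∧
            (T x f : Lp ℂ 2 gaussMeasure) =ᵐ[gaussMeasure]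
              fockTransform (x : ℂ × ℂ).1 (x : ℂ × ℂ).2 (f : Lp ℂ 2 gaussMeasure)) ∧
          IsUnitaryProjectiveRep T ∧
          ∀ x y : S, ∃ ε : ℂ, (ε = 1 ∨ ε = -1) ∧ T (x * y) = ε • (T x * T y) :=
  ⟨groupGLCC, coe_mul_GLCC, SLCCSubgroup, image_SLCCSubgroup,
    ⟨GLEquivGLCC, coe_GLEquivGLCC, image_GLEquivGLCC⟩, fockRep,
    fun x f => ⟨fun z => (inner_fockKernelLeft _ x.2 z f).1, by
      rw [fockTransform_eq_inner _ x.2]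
      exact coeFn_eq_inner_fockExp _⟩,
    isUnitaryProjectiveRep_fockRep, exists_sign_fockRep_mul⟩
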